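/- Let $\Omega$ be a non-empty finite set of outcomes and let $\Lambda\subseteq[0,\infty]^\Omega$ be a set of predictions such that $\Lambda$ is compact (in the product of the extended topologies of $[0,\infty]$) and contains a point $g$ with $g(\omega)<\infty$ for all $\omega\in\Omega$. Relations and operations on $[0,\infty]^\Omega$ are pointwise, with $e^{-\infty}=0$, $\ln 0=-\infty$ and $\frac10=\infty$, $\ln\infty=\infty$. Let $\Sigma_\Lambda=\{g\in[0,\infty]^\Omega\mid \exists\gamma\in\Lambda:\ \gamma\le g\}$ and, for a real $\eta>0$, let $\Sigma_\Lambda^\eta$ be the set of all points $-\frac1\eta\ln\sum_{g\in G}\rho(g)e^{-\eta g}$, where $G$ is a finite subset of $\Sigma_\Lambda$ and $\rho$ is a probability distribution on $G$. Assume that the game is $\eta$-mixable, that is, $\Sigma_\Lambda=\Sigma_\Lambda^\eta$. Let $\Theta$ be a finite or countable set of experts and let $P_0$ be a probability distribution on $\Theta$. Consider the following protocol. At each step $n=1,2,\dots$ all experts $\theta\in\Theta$ announce continuous functions $\Gamma_n^\theta\colon\Lambda\to\Lambda$, then Learner announces $\gamma_n\in\Lambda$, then Reality announces $\omega_n\in\Omega$.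 Put $L_N=\sum_{n=1}^N\gamma_n(\omega_n)$ and $L_N^\theta=\sum_{n=1}^N\Gamma_n^\theta(\gamma_n)(\omega_n)$. Then Learner has a strategy ($\gamma_N$ being a function of $\Gamma_1,\dots,\Gamma_N$ and $\omega_1,\dots,\omega_{N-1}$ only, depending on the parameters $\eta$ and $P_0$) which is a modification of the Aggregating Algorithm in the sense that at each step $N$, with the weights $P_{N-1}(\theta)=P_0(\theta)\prod_{n=1}^{N-1}e^{-\eta\Gamma_n^\theta(\gamma_n)(\omega_n)}$, its prediction satisfies $$\gamma_N\le-\frac1\eta\ln\left(\sum_{\theta\in\Theta}\frac{P_{N-1}(\theta)}{\sum_{\theta'\in\Theta}P_{N-1}(\theta')}\,e^{-\eta\Gamma_N^\theta(\gamma_N)}\right)$$ (no requirement if all the weights are $0$), and which guarantees, whatever the experts and Reality announce, that at each step $N$ and for all experts $\theta\in\Theta$ $$L_N\le L_N^\theta+\frac1\eta\ln\frac1{P_0(\theta)}.$$ -/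

import Mathlib

open scoped ENNReal

noncomputable section

namespace PredictionGame

/-- The number `exp (-η x)` for a loss `x ∈ [0, ∞]`, with `exp (-η ∞) = 0` when `η > 0`. -/
def expNeg (η : ℝ) (x : ℝ≥0∞) : ℝ≥0∞ := EReal.exp (-((η : EReal) * (x : EReal)))

/-- The number `-(1/η) ln s` for `s ∈ [0, 1]` and `η > 0`, as an element of `[0, ∞]`,
with value `∞` at `s = 0`. -/
def negLog (η : ℝ) (s : ℝ≥0∞) : ℝ≥0∞ :=
  (((1 / η : ℝ) : EReal) * (-ENNReal.log s)).toENNReal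

/-- A game of prediction with outcome set `Ω` is given by its prediction set
`Λ ⊆ [0, ∞]^Ω`; its superpredictions are the points that dominate some prediction. -/
def superpredictions {Ω : Type*} (Λ : Set (Ω → ℝ≥0∞)) : Set (Ω → ℝ≥0∞) :=
  {g | ∃ γ ∈ Λ, γ ≤ g}

/-- The exp-convex hull of `S`: all points `-(1/η) ln (∑ g ∈ G, ρ g * exp (-η g))` with `G` a
finite subset of `S` and `ρ` a probability distribution on `G`. -/
def expConvexHull {Ω : Type*} (η : ℝ) (S : Set (Ω → ℝ≥0∞)) : Set (Ω → ℝ≥0∞) :=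
  {h | ∃ (G : Finset (Ω → ℝ≥0∞)) (ρ : (Ω → ℝ≥0∞) → ℝ≥0∞),
    (G : Set (Ω → ℝ≥0∞)) ⊆ S ∧ ∑ g ∈ G, ρ g = 1 ∧
      h = fun ω => negLog η (∑ g ∈ G, ρ g * expNeg η (g ω))}

/-- The game is `η`-mixable. -/
def IsMixable {Ω : Type*} (η : ℝ) (Λ : Set (Ω → ℝ≥0∞)) : Prop :=
  superpredictions Λ = expConvexHull η (superpredictions Λ)

/-- A (deterministic) strategy of Learner against second-guessing experts that announce
continuous functions `Λ → Λ`. Steps are numbered from `0`. At step `n` Learner has seen the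
experts' functions of the steps `0, …, n` and the outcomes of the steps `0, …, n - 1`; Learner's
own earlier predictions are determined by these data. -/
def Strategy {Ω : Type*} (Θ : Type*) (Λ : Set (Ω → ℝ≥0∞)) :=
  (n : ℕ) → (Fin (n + 1) → Θ → C(Λ, Λ)) → (Fin n → Ω) → Λ

section Play

variable {Ω Θ : Type*} {Λ : Set (Ω → ℝ≥0∞)}

/-- Learner's prediction at step `n`, when the experts announce `Γ` and Reality announces `ω`. -/
def prediction (S : Strategy Θ Λ) (Γ : ℕ → Θ → C(Λ, Λ)) (ω : ℕ → Ω) (n : ℕ) : Λ :=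
  S n (fun k => Γ k) (fun k => ω k)

/-- Loss suffered at step `n` by expert `θ`, namely `Γ_n^θ(γ_n)(ω_n)`. -/
def expertStepLoss (S : Strategy Θ Λ) (Γ : ℕ → Θ → C(Λ, Λ)) (ω : ℕ → Ω) (θ : Θ) (n : ℕ) :
    ℝ≥0∞ :=
  (Γ n θ (prediction S Γ ω n) : Ω → ℝ≥0∞) (ω n)

/-- Learner's cumulative loss over the first `N` steps. -/
def learnerLoss (S : Strategy Θ Λ) (Γ : ℕ → Θ → C(Λ, Λ)) (ω : ℕ → Ω) (N : ℕ) : ℝ≥0∞ :=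
  ∑ n ∈ Finset.range N, (prediction S Γ ω n : Ω → ℝ≥0∞) (ω n)

/-- The cumulative loss of expert `θ` over the first `N` steps. -/
def expertLoss (S : Strategy Θ Λ) (Γ : ℕ → Θ → C(Λ, Λ)) (ω : ℕ → Ω) (θ : Θ) (N : ℕ) : ℝ≥0∞ :=
  ∑ n ∈ Finset.range N, expertStepLoss S Γ ω θ n

/-- The weight of expert `θ` in the Aggregating Algorithm after the first `N` steps. -/
def weight (η : ℝ) (P₀ : PMF Θ) (S : Strategy Θ Λ) (Γ : ℕ → Θ → C(Λ, Λ)) (ω : ℕ → Ω)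
    (N : ℕ) (θ : Θ) : ℝ≥0∞ :=
  P₀ θ * ∏ n ∈ Finset.range N, expNeg η (expertStepLoss S Γ ω θ n)

/-- The strategy is a second-guessing modification of the Aggregating Algorithm with parameters
`η` and `P₀`: each prediction `γ` of Learner solves
`γ ≤ -(1/η) ln (∑ θ, p θ * exp (-η Γ^θ(γ)))`, where `p` is the normalized weight
and `Γ^θ` are the functions announced at that step. If all weights vanish, then `0 / 0 = 0` makes
the right-hand side `∞` and any prediction is allowed. -/
def IsModifiedAA (η : ℝ) (P₀ : PMF Θ) (S : Strategy Θ Λ) : Prop :=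
  ∀ (Γ : ℕ → Θ → C(Λ, Λ)) (ω : ℕ → Ω) (N : ℕ) (o : Ω),
    (prediction S Γ ω N : Ω → ℝ≥0∞) o ≤
      negLog η (∑' θ, weight η P₀ S Γ ω N θ / (∑' θ', weight η P₀ S Γ ω N θ') *
        expNeg η ((Γ N θ (prediction S Γ ω N) : Ω → ℝ≥0∞) o))

end Play

end PredictionGame

end

/-! Pass to the coordinates exp(-ηg). Predictions become a compact set K in the unit cube and
superpredictions a compact set A ⊇ K, convex by mixability, in which every point lies coordinatewise
below a point of K. For weights p of total at most 1, F(γ) = ∑ p_θ exp(-ηΓ^θ(γ)) is a continuous map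
from K to A, and one step of the algorithm needs x ∈ K with F(x) ≤ x.

Brouwer's theorem does not apply directly: K need not be convex, and a dominating point of K need
not depend continuously on the point dominated. Instead, for u in the simplex and t > 0, let y be
the metric projection of 1 + tu onto A. It lies in K, and its variational inequality gives ∑ u_i
(F(y)_i - y_i) ≤ n/t with n = |Ω|. The Gale–Nikaido–Debreu lemma turns this into F(y) ≤ y + n²/t for
some u, and compactness removes the error (`exists_map_le_self_of_convex`). That lemma rests on
Brouwer's theorem, which is derived from Scarf's lemma by a parity count.

For the loss bound, each step multiplies the total weight by at most exp(-η · Learner's loss), so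
the total stays below exp(-η L_N). Each expert's weight is at most the total, and logarithms finish.
-/

section Scarf

/-! ### Scarf's combinatorial lemma. -/

open Finset

/-- A finite set `R` is dominant for the family of rankings `r` if every point is, for some
ranking `r i`, weakly below all of `R`. -/
def IsDominant {X I : Type*} (r : I → X → ℕ) (R : Finset X) : Prop :=
  ∀ y, ∃ i, ∀ x ∈ R, r i y ≤ r i x

theorem IsDominant.mono {X I : Type*} {r : I → X → ℕ} {R S : Finset X} (h : IsDominant r R)
    (hS : S ⊆ R) : IsDominant r S := fun y =>
  (h y).imp fun _ hi x hx => hi x (hS hx)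

/-- The count is 0 or 2. If erasing x₀ leaves every colour but i₀ exactly once, then x₀ itself is
not coloured i₀, so its colour recurs at a single other point x₁, and only x₀ and x₁ can be erased.
-/
theorem even_card_erase_image_eq {X I : Type*} [DecidableEq X] [DecidableEq I] [Fintype I]
    (c : X → I) (i₀ : I) (R : Finset X) (hR : R.card = Fintype.card I)
    (hne : R.image c ≠ univ) :
    Even (R.filter fun x => (R.erase x).image c = univ.erase i₀).card := by
  have hinj : ∀ x ∈ R, (R.erase x).image c = univ.erase i₀ → Set.InjOn c (R.erase x) := by
    intro x hx h
    rw [← card_image_iff, h, card_erase_of_mem (mem_univ _), card_erase_of_mem hx, card_univ, hR]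
  rcases (R.filter fun x => (R.erase x).image c = univ.erase i₀).eq_empty_or_nonempty with h | h
  · simp [h]
  obtain ⟨x₀, hx₀⟩ := h
  obtain ⟨hx₀R, hx₀⟩ := mem_filter.1 hx₀
  have hc : c x₀ ≠ i₀ := by
    intro hc
    apply hne
    rw [← insert_erase hx₀R, image_insert, hx₀, hc, insert_erase (mem_univ _)]
  have : c x₀ ∈ (R.erase x₀).image c := by rw [hx₀]; simp [hc]
  obtain ⟨x₁, hx₁, hc₁⟩ := mem_image.1 this
  have hx₁R := mem_of_mem_erase hx₁
  have hne₁ : x₁ ≠ x₀ := ne_of_mem_erase hx₁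
  have : (R.filter fun x => (R.erase x).image c = univ.erase i₀) = {x₀, x₁} := by
    ext x
    simp only [mem_filter, mem_insert, mem_singleton]
    constructor
    · rintro ⟨hx, hxc⟩
      by_contra! hcon
      exact hne₁ (hinj x hx hxc (by simp [hx₁R, hcon.2.symm]) (by simp [hx₀R, hcon.1.symm]) hc₁)
    · rintro (rfl | rfl)
      · exact ⟨hx₀R, hx₀⟩
      · refine ⟨hx₁R, ?_⟩
        rw [← hx₀]
        ext i
        simp only [mem_image, mem_erase]
        constructor
        · rintro ⟨y, ⟨hy, hyR⟩, rfl⟩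
          by_cases h : y = x₀
          · exact ⟨x, ⟨hne₁, hx₁R⟩, by rw [h, hc₁]⟩
          · exact ⟨y, ⟨h, hyR⟩, rfl⟩
        · rintro ⟨y, ⟨hy, hyR⟩, rfl⟩
          by_cases h : y = x
          · exact ⟨x₀, ⟨hne₁.symm, hx₀R⟩, by rw [h, hc₁]⟩
          · exact ⟨y, ⟨h, hyR⟩, rfl⟩
  rw [this, card_pair hne₁.symm]
  exact even_two

section Door

variable {X I : Type*}
  (r : I → X → ℕ) (a : I → X)

/-- The points that are above `a l` in every ranking `r l` with `l ≠ k`. -/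
def aboveExcept (k : I) : Set X := {y | ∀ l, l ≠ k → r l (a l) < r l y}

/-- The points of `aboveExcept r a k` that are highest in the ranking `r k`. -/
def topExcept (k : I) : Set X :=
  {x | x ∈ aboveExcept r a k ∧ ∀ y ∈ aboveExcept r a k, r k y ≤ r k x}

variable {r a}

theorem ncard_topExcept [Finite X] (hr : ∀ i, Function.Injective (r i)) {k : I}
    (h : (aboveExcept r a k).Nonempty) : (topExcept r a k).ncard = 1 := by
  obtain ⟨x, hx, hmax⟩ := (Set.toFinite (aboveExcept r a k)).exists_maximalFor (r k) _ h
  rw [Set.ncard_eq_one]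
  refine ⟨x, Set.eq_singleton_iff_unique_mem.2 ⟨⟨hx, fun y hy => ?_⟩, fun y hy => ?_⟩⟩
  · rcases le_total (r k y) (r k x) with h | h
    · exact h
    · exact hmax hy h
  · have h1 := hy.2 x hx
    exact hr k (le_antisymm (hmax hy.1 h1) h1)

theorem isDominant_insert_of_mem_topExcept [DecidableEq X] {τ : Finset X} (hτ : IsDominant r τ)
    (haτ : ∀ i, a i ∈ τ) (ha : ∀ i, ∀ x ∈ τ, r i (a i) ≤ r i x) (hsurj : ∀ y ∈ τ, ∃ i, a i = y)
    {k k' : I} (hk : k' ≠ k) (hkk : a k = a k') {x : X} (hx : x ∈ topExcept r a k) :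
    x ∉ τ ∧ IsDominant r (insert x τ) := by
  obtain ⟨hx1, hx2⟩ := hx
  refine ⟨fun hxτ => ?_, fun y => ?_⟩
  · obtain ⟨l, rfl⟩ := hsurj x hxτ
    by_cases h : l = k
    · subst h
      exact absurd (hx1 k' hk) (by rw [hkk]; exact lt_irrefl _)
    · exact lt_irrefl _ (hx1 l h)
  · by_cases hy : y ∈ aboveExcept r a k
    · refine ⟨k, ?_⟩
      simp only [mem_insert, forall_eq_or_imp]
      refine ⟨hx2 y hy, fun z hz => (hx2 y hy).trans ?_⟩
      obtain ⟨l, hl⟩ := hτ x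
      by_cases h : l = k
      · exact h ▸ hl z hz
      · exact absurd (hl _ (haτ l)) (not_le.2 (hx1 l h))
    · simp only [aboveExcept, Set.mem_ofPred_eq, not_forall, not_lt] at hy
      obtain ⟨l, hlk, hl⟩ := hy
      refine ⟨l, ?_⟩
      simp only [mem_insert, forall_eq_or_imp]
      exact ⟨hl.trans (hx1 l hlk).le, fun z hz => hl.trans (ha l z hz)⟩

/-- The |I| row minima `a` cover the |I| - 1 points of τ, so exactly one minimum is shared, by i and
j. A point added to τ must leave each old point minimal in some ranking, so it can undercut only in
ranking i or only in ranking j, and dominance makes it the highest candidate there. A point in both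
sets would lie above all minima, against dominance of τ. -/
theorem setOf_insert_dominant_eq [DecidableEq X] [Fintype I] (hr : ∀ i, Function.Injective (r i))
    {τ : Finset X} (hτ : IsDominant r τ)
    (hcard : τ.card + 1 = Fintype.card I)
    (haτ : ∀ i, a i ∈ τ) (ha : ∀ i, ∀ x ∈ τ, r i (a i) ≤ r i x)
    {i j : I} (hij : i ≠ j) (haij : a i = a j) :
    {x | x ∉ τ ∧ IsDominant r (insert x τ)} = topExcept r a i ∪ topExcept r a j ∧
      Disjoint (topExcept r a i) (topExcept r a j) := by
  classical
  have hsurj : ∀ y ∈ τ, ∃ i, a i = y := by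
    intro y hy
    obtain ⟨i, hi⟩ := hτ y
    exact ⟨i, hr i (le_antisymm (ha i y hy) (hi _ (haτ i)))⟩
  have hinj : Set.InjOn a (univ.erase i : Finset I) := by
    rw [← card_image_iff]
    have : (univ.erase i).image a = τ := by
      ext y
      simp only [mem_image, mem_erase]
      constructor
      · rintro ⟨l, -, rfl⟩; exact haτ l
      · intro hy
        obtain ⟨l, rfl⟩ := hsurj y hy
        by_cases h : l = i
        · exact ⟨j, ⟨hij.symm, mem_univ _⟩, by rw [h, haij]⟩
        · exact ⟨l, ⟨h, mem_univ _⟩, rfl⟩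
    rw [this, card_erase_of_mem (mem_univ _), card_univ]
    omega
  have huniq : ∀ l m, l ≠ i → l ≠ j → a m = a l → m = l := by
    intro l m hli hlj h
    by_cases hm : m = i
    · exact absurd (hinj (by simp [hli]) (by simp [hij.symm]) (by rw [← h, hm, haij])) hlj
    · exact hinj (by simp [hm]) (by simp [hli]) h
  refine ⟨?_, ?_⟩
  · ext x
    constructor
    · rintro ⟨hxτ, hx⟩
      have key : ∀ p ∈ τ, ∃ l, a l = p ∧ r l (a l) < r l x := by
        intro p hp
        obtain ⟨l, hl⟩ := hx p
        have h1 : a l = p :=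
          hr l (le_antisymm (ha l p hp) (hl _ (mem_insert_of_mem (haτ l))))
        refine ⟨l, h1, lt_of_le_of_ne (h1 ▸ hl x (mem_insert_self _ _)) fun h => ?_⟩
        exact hxτ (hr l h ▸ haτ l)
      have key1 : ∀ l, l ≠ i → l ≠ j → r l (a l) < r l x := by
        intro l hli hlj
        obtain ⟨m, hm, hmx⟩ := key (a l) (haτ l)
        rwa [huniq l m hli hlj hm] at hmx
      have key2 : ∀ k, x ∈ aboveExcept r a k → x ∈ topExcept r a k := by
        refine fun k hk => ⟨hk, fun y hy => ?_⟩
        obtain ⟨l, hl⟩ := hx y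
        by_cases h : l = k
        · exact h ▸ hl x (mem_insert_self _ _)
        · exact absurd (hl _ (mem_insert_of_mem (haτ l))) (not_le.2 (hy l h))
      by_cases hj : r j (a j) < r j x
      · refine Or.inl (key2 i fun l hl => ?_)
        by_cases h : l = j
        · exact h ▸ hj
        · exact key1 l hl h
      · refine Or.inr (key2 j fun l hl => ?_)
        by_cases h : l = i
        · subst h
          obtain ⟨m, hm, hmx⟩ := key (a l) (haτ l)
          by_cases hml : m = l
          · rwa [hml] at hmx
          · by_cases hmj : m = j
            · exact absurd (hmj ▸ hmx) hj
            · exact absurd (huniq m l hml hmj hm.symm).symm hml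
        · exact key1 l h hl
    · rintro (hx | hx)
      · exact isDominant_insert_of_mem_topExcept hτ haτ ha hsurj hij.symm haij hx
      · exact isDominant_insert_of_mem_topExcept hτ haτ ha hsurj hij haij.symm hx
  · rw [Set.disjoint_left]
    rintro x ⟨h1, -⟩ ⟨h2, -⟩
    obtain ⟨l, hl⟩ := hτ x
    by_cases h : l = i
    · subst h
      exact absurd (hl _ (haτ l)) (not_le.2 (h2 l hij))
    · exact absurd (hl _ (haτ l)) (not_le.2 (h1 l h))

end Door

/-- **Scarf's lemma**: for rankings `r i` of a finite set with slack points `s i`, every colouring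
that gives `s i` the colour `i` has a dominant set on which each colour occurs exactly once. -/
theorem exists_dominant_image_eq_univ {X I : Type*} [Fintype X] [DecidableEq X] [Fintype I]
    [DecidableEq I] [Nontrivial I] (r : I → X → ℕ) (hr : ∀ i, Function.Injective (r i))
    (s : I → X) (hs : ∀ i x, r i (s i) ≤ r i x)
    (hs' : ∀ i j, i ≠ j → ∀ x ∉ Set.range s, r i x < r i (s j))
    (hT : ∃ x, x ∉ Set.range s) (c : X → I) (hc : ∀ i, c (s i) = i) :
    ∃ R : Finset X, R.card = Fintype.card I ∧ IsDominant r R ∧ R.image c = univ := by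
  classical
  by_contra! hno
  obtain ⟨i₀⟩ : Nonempty I := inferInstance
  have hsinj : Function.Injective s := Function.LeftInverse.injective hc
  have hn2 : 1 < Fintype.card I := Fintype.one_lt_card
  -- Incidences of doors in rooms are counted twice. Without a fully coloured room, each room has
  -- evenly many doors; but every door lies in two rooms, except the all-slack door τ₀, which lies
  -- in one.
  let rooms : Finset (Finset X) :=
    univ.filter fun R => R.card = Fintype.card I ∧ IsDominant r R
  let doors : Finset (Finset X) :=
    univ.filter fun τ => τ.card + 1 = Fintype.card I ∧ IsDominant r τ ∧
      τ.image c = univ.erase i₀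
  have hcount := sum_card_bipartiteAbove_eq_sum_card_bipartiteBelow
    (s := rooms) (t := doors) (fun R τ => τ ⊆ R)
  have heven : Even (∑ R ∈ rooms, (doors.bipartiteAbove (fun R τ => τ ⊆ R) R).card) := by
    refine even_sum _ fun R hR => ?_
    obtain ⟨hRc, hRd⟩ := (mem_filter.1 hR).2
    have := even_card_erase_image_eq c i₀ R hRc (hno R hRc hRd)
    suffices hbij : (R.filter fun x => (R.erase x).image c = univ.erase i₀).card =
        (doors.bipartiteAbove (fun R τ => τ ⊆ R) R).card by rwa [← hbij]
    refine card_bij (fun x _ => R.erase x) ?_ ?_ ?_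
    · intro x hx
      obtain ⟨hxR, hx⟩ := mem_filter.1 hx
      simp only [bipartiteAbove, doors, mem_filter, mem_univ, true_and]
      refine ⟨⟨?_, hRd.mono (erase_subset _ _), hx⟩, erase_subset _ _⟩
      rw [card_erase_of_mem hxR, hRc]; omega
    · intro x hx y hy h
      exact (erase_inj R (mem_filter.1 hx).1).1 h
    · intro τ hτ
      simp only [bipartiteAbove, doors, mem_filter, mem_univ, true_and] at hτ
      obtain ⟨⟨h1, h2, h3⟩, h4⟩ := hτ
      have h5 : (R \ τ).card = 1 := by rw [card_sdiff_of_subset h4]; omega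
      obtain ⟨x, hx⟩ := card_eq_one.1 h5
      have hxR : x ∈ R \ τ := by simp [hx]
      have h6 : R.erase x = τ := by
        rw [erase_eq, ← hx, Finset.sdiff_sdiff_eq_self h4]
      exact ⟨x, by simp [(mem_sdiff.1 hxR).1, h6, h3], h6⟩
  have hdoor : ∀ τ ∈ doors, (rooms.bipartiteBelow (fun R τ => τ ⊆ R) τ).card =
      {x | x ∉ τ ∧ IsDominant r (insert x τ)}.ncard := by
    intro τ hτ
    obtain ⟨h1, h2, h3⟩ := (mem_filter.1 hτ).2
    rw [Set.ncard_eq_toFinset_card']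
    symm
    refine card_bij (fun x _ => insert x τ) ?_ ?_ ?_
    · intro x hx
      simp only [Set.mem_toFinset, Set.mem_ofPred_eq] at hx
      simp only [bipartiteBelow, rooms, mem_filter, mem_univ, true_and]
      exact ⟨⟨by rw [card_insert_of_notMem hx.1, h1], hx.2⟩, subset_insert _ _⟩
    · intro x hx y hy h
      simp only [Set.mem_toFinset, Set.mem_ofPred_eq] at hx hy
      exact (insert_inj hx.1).1 h
    · intro R hR
      simp only [bipartiteBelow, rooms, mem_filter, mem_univ, true_and] at hR
      obtain ⟨⟨h4, h5⟩, h6⟩ := hR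
      have h7 : (R \ τ).card = 1 := by rw [card_sdiff_of_subset h6]; omega
      obtain ⟨x, hx⟩ := card_eq_one.1 h7
      have hxR : x ∈ R \ τ := by simp [hx]
      have h8 : insert x τ = R := by
        rw [insert_eq, ← hx, sdiff_union_of_subset h6]
      exact ⟨x, by simp [(mem_sdiff.1 hxR).2, h8, h5], h8⟩
  have hargmin : ∀ τ ∈ doors, ∃ a : I → X, (∀ i, a i ∈ τ) ∧ ∀ i, ∀ x ∈ τ, r i (a i) ≤ r i x := by
    intro τ hτ
    obtain ⟨h1, h2, h3⟩ := (mem_filter.1 hτ).2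
    have : τ.Nonempty := card_pos.1 (by omega)
    choose a ha using fun i => exists_min_image τ (r i) this
    exact ⟨a, fun i => (ha i).1, fun i => (ha i).2⟩
  let τ₀ : Finset X := (univ.erase i₀).image s
  have hτ₀ : τ₀ ∈ doors := by
    simp only [doors, mem_filter, mem_univ, true_and, τ₀]
    refine ⟨?_, ?_, ?_⟩
    · rw [card_image_of_injective _ hsinj, card_erase_of_mem (mem_univ _), card_univ]; omega
    · intro y
      by_cases hy : y ∈ Set.range s
      · obtain ⟨k, rfl⟩ := hy
        exact ⟨k, fun x _ => hs k x⟩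
      · refine ⟨i₀, fun x hx => ?_⟩
        obtain ⟨l, hl, rfl⟩ := mem_image.1 hx
        exact (hs' i₀ l (ne_of_mem_erase hl).symm y hy).le
    · rw [image_image]
      have : c ∘ s = id := funext hc
      rw [this, image_id]
  have hone : (rooms.bipartiteBelow (fun R τ => τ ⊆ R) τ₀).card = 1 := by
    rw [hdoor τ₀ hτ₀]
    obtain ⟨a, haτ, ha⟩ := hargmin τ₀ hτ₀
    obtain ⟨h1, h2, h3⟩ := (mem_filter.1 hτ₀).2
    have has : ∀ l, l ≠ i₀ → a l = s l := by
      intro l hl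
      exact hr l (le_antisymm (ha l (s l) (mem_image_of_mem s (by simp [hl]))) (hs l _))
    obtain ⟨j, hj, hja⟩ := mem_image.1 (haτ i₀)
    have hj₀ : j ≠ i₀ := ne_of_mem_erase hj
    obtain ⟨heq, hdisj⟩ := setOf_insert_dominant_eq hr h2 h1 haτ ha hj₀.symm
      (by rw [has j hj₀, hja])
    rw [heq, Set.ncard_union_eq hdisj, ncard_topExcept hr]
    · have : topExcept r a j = ∅ := by
        rw [Set.eq_empty_iff_forall_notMem]
        rintro y ⟨hy, -⟩
        have hy₀ := hy i₀ hj₀.symm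
        rw [← hja] at hy₀
        by_cases hyr : y ∈ Set.range s
        · obtain ⟨m, rfl⟩ := hyr
          by_cases hm₀ : m = i₀
          · exact absurd (hs i₀ (s j)) (not_le.2 (hm₀ ▸ hy₀))
          · by_cases hmj : m = j
            · exact lt_irrefl _ (hmj ▸ hy₀)
            · have := hy m hmj
              rw [has m hm₀] at this
              exact lt_irrefl _ this
        · exact lt_asymm hy₀ (hs' i₀ j hj₀.symm y hyr)
      rw [this, Set.ncard_empty]
    · obtain ⟨t, ht⟩ := hT
      refine ⟨t, fun l hl => ?_⟩
      rw [has l hl]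
      exact lt_of_le_of_ne (hs l t) fun h => ht ⟨l, hr l h⟩
  have htwo : ∀ τ ∈ doors.erase τ₀,
      (rooms.bipartiteBelow (fun R τ => τ ⊆ R) τ).card = 2 := by
    intro τ hτ'
    have hne := ne_of_mem_erase hτ'
    have hτ := mem_of_mem_erase hτ'
    rw [hdoor τ hτ]
    obtain ⟨a, haτ, ha⟩ := hargmin τ hτ
    obtain ⟨h1, h2, h3⟩ := (mem_filter.1 hτ).2
    -- A door made of slack points only is forced by its colours to be τ₀. A non-slack point makes
    -- `s k` a member of `aboveExcept r a k` for every k, so both top sets are nonempty.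
    obtain ⟨x, hxτ, hx⟩ : ∃ x ∈ τ, x ∉ Set.range s := by
      by_contra! hcon
      apply hne
      refine eq_of_subset_of_card_le (fun x hx => ?_) ?_
      · obtain ⟨l, rfl⟩ := hcon x hx
        have : c (s l) ∈ τ.image c := mem_image_of_mem c hx
        rw [hc, h3] at this
        exact mem_image_of_mem s this
      · have := (mem_filter.1 hτ₀).2.1
        omega
    obtain ⟨i, -, j, -, hij, haij⟩ := exists_ne_map_eq_of_card_lt_of_maps_to
      (s := univ) (t := τ) (f := a) (by rw [card_univ]; omega) (fun i _ => haτ i)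
    obtain ⟨heq, hdisj⟩ := setOf_insert_dominant_eq hr h2 h1 haτ ha hij haij
    have hab : ∀ k, (aboveExcept r a k).Nonempty := fun k =>
      ⟨s k, fun l hl => (ha l x hxτ).trans_lt (hs' l k hl x hx)⟩
    rw [heq, Set.ncard_union_eq hdisj, ncard_topExcept hr (hab i), ncard_topExcept hr (hab j)]
  rw [hcount, ← add_sum_erase _ _ hτ₀, hone, sum_congr rfl htwo, sum_const, smul_eq_mul] at heven
  rw [Nat.even_iff] at heven
  omega

end Scarf

/-! ### Brouwer's fixed point theorem on the simplex. -/

section Brouwer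

open Finset

/-- For every colouring of the grid points of a simplex there are grid points `z i`, one for each
colour `i` in a nonempty set `C`, that lie close together and close to the face spanned by `C`. -/
theorem exists_close_coloured_grid_points {I : Type*} [Fintype I] [Nontrivial I] (N : ℕ)
    (c : (I → ℕ) → I) :
    ∃ (C : Finset I) (z : I → I → ℕ), C.Nonempty ∧
      (∀ i ∈ C, ∑ l, z i l = N ∧ c (z i) = i) ∧
      (∀ i ∈ C, ∀ j ∈ C, ∀ l, z i l ≤ z j l + Fintype.card I) ∧
      ∀ i ∈ C, ∀ l, l ∉ C → z i l < Fintype.card I := by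
  classical
  let T := {x : I → ℕ // x ∈ piAntidiag univ N}
  let : Fintype T := FinsetCoe.fintype _
  have memT : ∀ x : I → ℕ, ∑ l, x l = N → x ∈ piAntidiag univ N := fun x hx => by simp [hx]
  have sumT : ∀ x : T, ∑ l, x.1 l = N := fun x => (mem_piAntidiag.1 x.2).1
  have leT : ∀ (x : T) l, x.1 l ≤ N := fun x l =>
    (single_le_sum (f := x.1) (fun _ _ => Nat.zero_le _) (mem_univ l)).trans_eq (sumT x)
  obtain ⟨i₁⟩ : Nonempty I := inferInstance
  let t₀ : T := ⟨Pi.single i₁ N, memT _ (by simp)⟩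
  let M := Fintype.card T
  let e : T ≃ Fin M := Fintype.equivFin T
  let e' : I ≃ Fin (Fintype.card I) := Fintype.equivFin I
  have hM : 0 < M := Fintype.card_pos_iff.2 ⟨t₀⟩
  -- Grid points are ranked by their i-th coordinate, ties being broken by `e`. The shift by 1 puts
  -- them above slack i, which has rank 0, and the offset (N + 2) * M puts the other slacks above
  -- them.
  let r : I → T ⊕ I → ℕ := fun i => Sum.elim (fun x => (x.1 i + 1) * M + e x)
    fun j => if j = i then 0 else (N + 2) * M + e' j
  have hrT : ∀ i (x : T), M ≤ r i (Sum.inl x) ∧ r i (Sum.inl x) < (N + 2) * M := by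
    intro i x
    have h1 := (e x).2
    have h2 : (x.1 i + 2) * M ≤ (N + 2) * M := Nat.mul_le_mul_right _ (by linarith [leT x i])
    refine ⟨?_, ?_⟩
    · change M ≤ (x.1 i + 1) * M + e x
      nlinarith [Nat.zero_le (x.1 i * M)]
    · change (x.1 i + 1) * M + e x < _
      nlinarith
  have hrle : ∀ i (x y : T), r i (Sum.inl x) ≤ r i (Sum.inl y) → x.1 i ≤ y.1 i := by
    intro i x y h
    by_contra! hlt
    change (x.1 i + 1) * M + e x ≤ (y.1 i + 1) * M + e y at h
    have h1 := (e y).2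
    have h2 : (y.1 i + 2) * M ≤ (x.1 i + 1) * M := Nat.mul_le_mul_right _ (by omega)
    nlinarith
  have hr : ∀ i, Function.Injective (r i) := by
    intro i
    rintro (x | j) (y | k) h
    · change (x.1 i + 1) * M + e x = (y.1 i + 1) * M + e y at h
      have h1 := congrArg (· % M) h
      simp only [Nat.mul_add_mod_self_right, Nat.mod_eq_of_lt (e x).2,
        Nat.mod_eq_of_lt (e y).2] at h1
      exact congrArg _ (e.injective (Fin.ext h1))
    · have := hrT i x
      rw [h] at this
      by_cases hk : k = i <;> simp [r, hk] at this
      omega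
    · have := hrT i y
      rw [← h] at this
      by_cases hk : j = i <;> simp [r, hk] at this
      omega
    · have h1 : 0 < (N + 2) * M := by positivity
      by_cases hj : j = i <;> by_cases hk : k = i <;>
        simp only [r, Sum.elim_inr, hj, hk, if_true, if_false] at h
      · rw [hj, hk]
      · omega
      · omega
      · exact congrArg _ (e'.injective (Fin.ext (Nat.add_left_cancel h)))
  obtain ⟨R, -, hdom, himg⟩ := exists_dominant_image_eq_univ r hr Sum.inr
    (by intro i x; simp [r])
    (by
      intro i j hij x hx
      rcases x with x | k
      · have := (hrT i x).2
        simp only [r, Sum.elim_inr, if_neg hij.symm] at this ⊢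
        exact Nat.lt_add_right _ this
      · exact absurd ⟨k, rfl⟩ hx)
    ⟨Sum.inl t₀, by simp⟩ (Sum.elim (fun x => c x.1) id) (fun i => rfl)
  have hpre : ∀ i, ∃ x ∈ R, Sum.elim (fun x : T => c x.1) id x = i := by
    intro i
    rw [← mem_image, himg]
    exact mem_univ i
  let C : Finset I := univ.filter fun i => (Sum.inr i : T ⊕ I) ∉ R
  have hmemC : ∀ i, i ∈ C ↔ (Sum.inr i : T ⊕ I) ∉ R := fun i => by simp [C]
  have hz : ∀ i, ∃ x : T, i ∈ C → Sum.inl x ∈ R ∧ c x.1 = i := by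
    intro i
    by_cases hi : i ∈ C
    · obtain ⟨x | j, hxR, hx⟩ := hpre i
      · exact ⟨x, fun _ => ⟨hxR, hx⟩⟩
      · have : j = i := hx
        subst this
        exact absurd hxR ((hmemC _).1 hi)
    · exact ⟨t₀, fun h => absurd h hi⟩
  choose z hz using hz
  -- A ranking whose slack lies in R cannot witness dominance of a grid point, since that slack has
  -- rank 0.
  have hdomC : ∀ y : T, ∃ i ∈ C, ∀ x : T, Sum.inl x ∈ R → y.1 i ≤ x.1 i := by
    intro y
    obtain ⟨i, hi⟩ := hdom (Sum.inl y)
    refine ⟨i, (hmemC i).2 fun h => ?_, fun x hx => hrle i y x (hi _ hx)⟩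
    have h1 := hi _ h
    have h2 := (hrT i y).1
    simp only [r, Sum.elim_inr, if_true] at h1 h2
    omega
  obtain ⟨i₂, hi₂, -⟩ := hdomC t₀
  have hCne : C.Nonempty := ⟨i₂, hi₂⟩
  have hmin : ∀ l, ∃ k ∈ C, ∀ i ∈ C, (z k).1 l ≤ (z i).1 l := fun l =>
    exists_min_image C (fun i => (z i).1 l) hCne
  choose k hkC hk using hmin
  let m : I → ℕ := fun l => (z (k l)).1 l
  -- Otherwise some grid point would exceed every minimum m l with l ∈ C, against dominance; the
  -- mass left over is put on i₂ ∈ C.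
  have hsum : N < ∑ l ∈ C, (m l + 1) := by
    by_contra! hle
    have hy : ∑ l, ((if l ∈ C then m l + 1 else 0) +
        if l = i₂ then N - ∑ l ∈ C, (m l + 1) else 0) = N := by
      rw [sum_add_distrib, sum_ite_mem, univ_inter, sum_ite_eq' univ i₂, if_pos (mem_univ _)]
      omega
    obtain ⟨i, hi, hi'⟩ := hdomC ⟨_, memT _ hy⟩
    have := hi' (z (k i)) (hz _ (hkC i)).1
    simp only [if_pos hi] at this
    change _ ≤ m i at this
    omega
  rw [sum_add_distrib, sum_const, smul_eq_mul, mul_one] at hsum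
  have hCcard : C.card ≤ Fintype.card I := card_le_univ C
  have hsumC : ∀ i ∈ C, ∑ l ∈ C, m l ≤ ∑ l ∈ C, (z i).1 l := fun i hi =>
    sum_le_sum fun l _ => hk l i hi
  have hin : ∀ i ∈ C, ∀ l ∈ C, (z i).1 l < m l + Fintype.card I := by
    intro i hi l hl
    have h1 : ∑ l ∈ C, (z i).1 l ≤ N :=
      (sum_le_sum_of_subset (subset_univ _)).trans_eq (sumT (z i))
    have h2 : ∑ l ∈ C.erase l, m l ≤ ∑ l ∈ C.erase l, (z i).1 l :=
      sum_le_sum fun l _ => hk l i hi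
    rw [← add_sum_erase C _ hl] at h1 hsum
    omega
  have hout : ∀ i ∈ C, ∀ l, l ∉ C → (z i).1 l < Fintype.card I := by
    intro i hi l hl
    have h1 : ∑ l ∈ insert l C, (z i).1 l ≤ N :=
      (sum_le_sum_of_subset (subset_univ _)).trans_eq (sumT (z i))
    rw [sum_insert hl] at h1
    have := hsumC i hi
    omega
  refine ⟨C, fun i => (z i).1, hCne, fun i hi => ⟨sumT _, (hz i hi).2⟩, ?_, hout⟩
  intro i hi j hj l
  by_cases hl : l ∈ C
  · have h1 := hin i hi l hl
    have h2 : m l ≤ (z j).1 l := hk l j hj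
    change (z i).1 l ≤ (z j).1 l + _
    omega
  · exact (hout i hi l hl).le.trans (Nat.le_add_left _ _)

/-- Colour a grid point by a coordinate that f does not decrease; one exists because coordinates sum
to 1 before and after. For a colour in C, a nearby point of that colour and uniform continuity give
the bound; off C the coordinate itself is small. -/
theorem exists_sub_le_of_mapsTo_stdSimplex {I : Type*} [Fintype I] [Nontrivial I]
    {f : (I → ℝ) → I → ℝ} (hf : ContinuousOn f (stdSimplex ℝ I))
    (hmaps : Set.MapsTo f (stdSimplex ℝ I) (stdSimplex ℝ I)) {δ : ℝ} (hδ : 0 < δ) :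
    ∃ x ∈ stdSimplex ℝ I, ∀ i, x i - δ ≤ f x i := by
  obtain ⟨ε, hε, hunif⟩ := Metric.uniformContinuousOn_iff.1
    ((isCompact_stdSimplex ℝ I).uniformContinuousOn_of_continuous hf) (δ / 2) (half_pos hδ)
  have hnpos : (0 : ℝ) < Fintype.card I := by exact_mod_cast Fintype.card_pos
  obtain ⟨N, hN⟩ := exists_nat_gt ((Fintype.card I : ℝ) / min ε (δ / 2))
  have hmin : 0 < min ε (δ / 2) := lt_min hε (half_pos hδ)
  have hN0 : (0 : ℝ) < N := (div_pos hnpos hmin).trans hN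
  have hsmall : (Fintype.card I : ℝ) / N < min ε (δ / 2) := by
    rw [div_lt_iff₀ hmin] at hN
    rw [div_lt_iff₀ hN0]
    linarith
  let g : (I → ℕ) → I → ℝ := fun x l => x l / N
  have hg : ∀ x : I → ℕ, ∑ l, x l = N → g x ∈ stdSimplex ℝ I := by
    intro x hx
    refine ⟨fun l => by positivity, ?_⟩
    rw [← sum_div, ← Nat.cast_sum, hx, div_self hN0.ne']
  have hcol : ∀ x : I → ℕ, ∃ i, ∑ l, x l = N → g x i ≤ f (g x) i := by
    intro x
    by_cases hx : ∑ l, x l = N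
    · by_contra! hcon
      have h := sum_lt_sum_of_nonempty (s := univ) univ_nonempty fun i _ => (hcon i).2
      rw [(hg x hx).2, (hmaps (hg x hx)).2] at h
      exact lt_irrefl _ h
    · exact ⟨Classical.arbitrary I, fun h => absurd h hx⟩
  choose c hc using hcol
  obtain ⟨C, z, ⟨j, hj⟩, hz, hclose, hout⟩ := exists_close_coloured_grid_points N c
  have hle : ∀ i ∈ C, ∀ k ∈ C, ∀ l, g (z i) l ≤ g (z k) l + Fintype.card I / N := by
    intro i hi k hk l
    simp only [g]
    rw [← add_div]
    gcongr
    exact_mod_cast hclose i hi k hk l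
  refine ⟨g (z j), hg _ (hz j hj).1, fun i => ?_⟩
  by_cases hi : i ∈ C
  · have hdist : dist (g (z i)) (g (z j)) < ε := by
      rw [dist_pi_lt_iff hε]
      intro l
      rw [Real.dist_eq, abs_sub_lt_iff]
      have h1 := hle i hi j hj l
      have h2 := hle j hj i hi l
      have h3 := hsmall.trans_le (min_le_left _ _)
      constructor <;> linarith
    have h1 := hunif _ (hg _ (hz i hi).1) _ (hg _ (hz j hj).1) hdist
    have h2 := (dist_pi_lt_iff (half_pos hδ)).1 h1 i
    rw [Real.dist_eq, abs_sub_lt_iff] at h2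
    have h3 := hc (z i) (hz i hi).1
    rw [(hz i hi).2] at h3
    have h4 := hle j hj i hi i
    have h5 := hsmall.trans_le (min_le_right _ _)
    linarith [h2.1]
  · have h1 := (hmaps (hg _ (hz j hj).1)).1 i
    have h2 : g (z j) i ≤ Fintype.card I / N := by
      simp only [g]
      gcongr
      exact_mod_cast (hout j hj i hi).le
    have h3 := hsmall.trans_le (min_le_right _ _)
    linarith

theorem exists_forall_nonpos_of_forall_pos {X I : Type*} [TopologicalSpace X] [Fintype I]
    {K : Set X} (hK : IsCompact K) {g : X → I → ℝ} (hg : ContinuousOn g K)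
    (h : ∀ δ > 0, ∃ x ∈ K, ∀ i, g x i ≤ δ) : ∃ x ∈ K, ∀ i, g x i ≤ 0 := by
  have hcont : ContinuousOn (fun x => ∑ i, max (g x i) 0) K := by
    have := continuousOn_pi.1 hg
    fun_prop
  obtain ⟨x₀, hx₀, -⟩ := h 1 one_pos
  obtain ⟨x, hx, hxmin⟩ := hK.exists_isMinOn ⟨x₀, hx₀⟩ hcont
  refine ⟨x, hx, fun i => ?_⟩
  have : Nonempty I := ⟨i⟩
  have hn : (0 : ℝ) < Fintype.card I := by exact_mod_cast Fintype.card_pos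
  refine le_of_forall_pos_le_add fun δ hδ => ?_
  obtain ⟨y, hy, hyle⟩ := h _ (div_pos hδ hn)
  calc g x i ≤ max (g x i) 0 := le_max_left _ _
    _ ≤ ∑ i, max (g x i) 0 :=
      single_le_sum (f := fun i => max (g x i) 0) (fun _ _ => le_max_right _ _) (mem_univ i)
    _ ≤ ∑ i, max (g y i) 0 := hxmin hy
    _ ≤ ∑ _i : I, δ / Fintype.card I :=
      sum_le_sum fun i _ => max_le (hyle i) (by positivity)
    _ = 0 + δ := by
      rw [sum_const, card_univ, nsmul_eq_mul, mul_div_cancel₀ _ hn.ne', zero_add]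

/-- **Brouwer's fixed point theorem** for the standard simplex. -/
theorem exists_fixedPoint_of_mapsTo_stdSimplex {I : Type*} [Fintype I] [Nonempty I]
    {f : (I → ℝ) → I → ℝ} (hf : ContinuousOn f (stdSimplex ℝ I))
    (hmaps : Set.MapsTo f (stdSimplex ℝ I) (stdSimplex ℝ I)) :
    ∃ x ∈ stdSimplex ℝ I, f x = x := by
  classical
  have hne : (stdSimplex ℝ I).Nonempty :=
    ⟨_, single_mem_stdSimplex ℝ (Classical.arbitrary I)⟩
  rcases subsingleton_or_nontrivial I with hI | hI
  · obtain ⟨x, hx⟩ := hne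
    refine ⟨x, hx, funext fun i => ?_⟩
    have h1 := (hmaps hx).2
    have h2 := hx.2
    rw [Fintype.sum_subsingleton _ i] at h1 h2
    rw [h1, h2]
  obtain ⟨x, hx, hle⟩ := exists_forall_nonpos_of_forall_pos (g := fun x i => x i - f x i)
    (isCompact_stdSimplex ℝ I) (continuousOn_id.sub hf) fun δ hδ => by
      obtain ⟨x, hx, hle⟩ := exists_sub_le_of_mapsTo_stdSimplex hf hmaps hδ
      exact ⟨x, hx, fun i => sub_le_comm.1 (hle i)⟩
  refine ⟨x, hx, funext fun i => ?_⟩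
  -- x ≤ f x coordinatewise, and both have sum 1.
  have heq := (sum_eq_sum_iff_of_le fun i _ => sub_nonpos.1 (hle i)).1 (by rw [hx.2, (hmaps hx).2])
  exact (heq i (mem_univ i)).symm

end Brouwer

/-! ### From Brouwer's theorem to F(x) ≤ x on the dominating set K. -/

section Variational

open Finset

/-- The **Gale–Nikaido–Debreu lemma**, approximate version: a vector field on the simplex with
`∑ i, u i * v u i ≤ ε` is coordinatewise at most `n * ε` at some point. -/
theorem exists_forall_le_of_sum_mul_le {I : Type*} [Fintype I] [Nonempty I]
    {v : (I → ℝ) → I → ℝ} (hv : ContinuousOn v (stdSimplex ℝ I)) {ε : ℝ} (hε : 0 ≤ ε)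
    (h : ∀ u ∈ stdSimplex ℝ I, ∑ i, u i * v u i ≤ ε) :
    ∃ u ∈ stdSimplex ℝ I, ∀ i, v u i ≤ Fintype.card I * ε := by
  let w : (I → ℝ) → ℝ := fun u => ∑ i, max (v u i) 0
  have hw : ∀ u, 0 ≤ w u := fun u => sum_nonneg fun i _ => le_max_right _ _
  have hw1 : ∀ u, 1 + w u ≠ 0 := fun u => by have := hw u; positivity
  obtain ⟨u, hu, hfix⟩ := exists_fixedPoint_of_mapsTo_stdSimplex
    (f := fun u i => (u i + max (v u i) 0) / (1 + w u))
    (by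
      have := continuousOn_pi.1 hv
      refine continuousOn_pi.2 fun i => ContinuousOn.div (by fun_prop) (by fun_prop) fun u _ => hw1 u)
    (by
      intro u hu
      refine ⟨fun i => ?_, ?_⟩
      · have := hw u
        have := hu.1 i
        have := le_max_right (v u i) 0
        positivity
      · rw [← sum_div, sum_add_distrib, hu.2, div_self (hw1 u)])
  refine ⟨u, hu, ?_⟩
  -- At the fixed point the positive part of v is proportional to u, so its squared norm is w u * ∑
  -- u i * v u i ≤ w u * ε.
  have hpos : ∀ i, max (v u i) 0 = u i * w u := by
    intro i
    have := congrFun hfix i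
    change (u i + max (v u i) 0) / (1 + w u) = u i at this
    rw [div_eq_iff (hw1 u)] at this
    linarith
  obtain ⟨k, -, hk⟩ := exists_max_image univ (fun i => max (v u i) 0) univ_nonempty
  have hM0 : 0 ≤ max (v u k) 0 := le_max_right _ _
  have hwM : w u ≤ Fintype.card I * max (v u k) 0 := by
    have := sum_le_sum (s := univ) fun i hi => hk i hi
    rwa [sum_const, card_univ, nsmul_eq_mul] at this
  have hsq : max (v u k) 0 * max (v u k) 0 ≤ w u * ε := by
    calc max (v u k) 0 * max (v u k) 0 ≤ ∑ i, max (v u i) 0 * max (v u i) 0 :=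
          single_le_sum (f := fun i => max (v u i) 0 * max (v u i) 0)
            (fun i _ => mul_self_nonneg _) (mem_univ k)
      _ = ∑ i, w u * (u i * v u i) := by
          refine sum_congr rfl fun i _ => ?_
          have : max (v u i) 0 * max (v u i) 0 = max (v u i) 0 * v u i := by
            rcases le_total (v u i) 0 with h | h <;> simp [h]
          rw [this, hpos]
          ring
      _ ≤ w u * ε := by
          rw [← mul_sum]
          exact mul_le_mul_of_nonneg_left (h u hu) (hw u)
  intro i
  have hi : v u i ≤ max (v u k) 0 := (le_max_left _ _).trans (hk i (mem_univ i))
  refine hi.trans ?_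
  rcases hM0.eq_or_lt with h0 | h0
  · rw [← h0]; positivity
  · have := hsq.trans (mul_le_mul_of_nonneg_right hwM hε)
    refine le_of_mul_le_mul_right ?_ h0
    linarith

/-- Adding the variational inequalities at two points and applying Cauchy–Schwarz shows that the
projection is 1-Lipschitz. -/
theorem exists_continuous_metric_projection {E : Type*} [NormedAddCommGroup E]
    [InnerProductSpace ℝ E] {A : Set E} (hne : A.Nonempty) (hA : IsComplete A)
    (hconv : Convex ℝ A) :
    ∃ P : E → E, Continuous P ∧ ∀ z, P z ∈ A ∧ ∀ w ∈ A, inner ℝ (z - P z) (w - P z) ≤ 0 := by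
  choose P hPA hP using exists_norm_eq_iInf_of_complete_convex hne hA hconv
  have hin : ∀ z, ∀ w ∈ A, inner ℝ (z - P z) (w - P z) ≤ 0 := fun z =>
    (norm_eq_iInf_iff_real_inner_le_zero hconv (hPA z)).1 (hP z)
  refine ⟨P, ?_, fun z => ⟨hPA z, hin z⟩⟩
  refine (LipschitzWith.mk_one fun z z' => ?_).continuous
  rw [dist_eq_norm, dist_eq_norm]
  have h1 := hin z (P z') (hPA z')
  have h2 := hin z' (P z) (hPA z)
  have h3 : ‖P z - P z'‖ * ‖P z - P z'‖ ≤ ‖z - z'‖ * ‖P z - P z'‖ := by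
    refine le_trans ?_ (real_inner_le_norm _ _)
    rw [← real_inner_self_eq_norm_mul_norm]
    have h4 : inner ℝ (z - z') (P z - P z') - inner ℝ (P z - P z') (P z - P z') =
        -(inner ℝ (z - P z) (P z' - P z) + inner ℝ (z' - P z') (P z - P z')) := by
      rw [← inner_sub_left, ← neg_sub (P z) (P z'), inner_neg_right, ← sub_eq_neg_add,
        ← inner_sub_left, ← inner_neg_left]
      congr 1
      abel
    linarith
  rcases (norm_nonneg (P z - P z')).eq_or_lt with h | h
  · rw [← h]; exact norm_nonneg _
  · exact le_of_mul_le_mul_right h3 h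

/-- If `K` contains, up to domination, the maximal points of a compact convex subset `A` of the
unit cube, then every continuous `f : K → A` satisfies `f x ≤ x` for some `x ∈ K`. -/
theorem exists_map_le_self_of_convex {I : Type*} [Fintype I] [Nonempty I]
    {K A : Set (EuclideanSpace ℝ I)} (hK : IsCompact K) (hA : IsCompact A) (hconv : Convex ℝ A)
    (hne : A.Nonempty) (hcube : ∀ a ∈ A, ∀ i, 0 ≤ a i ∧ a i ≤ 1) (hKA : K ⊆ A)
    (hdom : ∀ a ∈ A, ∃ k ∈ K, ∀ i, a i ≤ k i)
    {f : EuclideanSpace ℝ I → EuclideanSpace ℝ I} (hf : ContinuousOn f K)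
    (hmaps : Set.MapsTo f K A) : ∃ x ∈ K, ∀ i, f x i ≤ x i := by
  obtain ⟨P, hPc, hP⟩ := exists_continuous_metric_projection hne hA.isComplete hconv
  suffices h : ∃ x ∈ K, ∀ i, f x i - x i ≤ 0 by simpa only [sub_nonpos] using h
  refine exists_forall_nonpos_of_forall_pos (g := fun x i => f x i - x i) hK
    (by
      refine continuousOn_pi.2 fun i => ?_
      have : ContinuousOn (fun x => f x i) K :=
        (EuclideanSpace.proj (𝕜 := ℝ) i).continuous.comp_continuousOn hf
      exact this.sub (EuclideanSpace.proj (𝕜 := ℝ) i).continuous.continuousOn) fun δ hδ => ?_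
  have hn : (0 : ℝ) < Fintype.card I := by exact_mod_cast Fintype.card_pos
  -- Chosen so that n * (n / t) = δ in the Gale–Nikaido–Debreu bound.
  let t : ℝ := Fintype.card I * Fintype.card I / δ
  have ht : 0 < t := by positivity
  let y : (I → ℝ) → EuclideanSpace ℝ I := fun u => P (WithLp.toLp 2 fun i => 1 + t * u i)
  have hyA : ∀ u, y u ∈ A := fun u => (hP _).1
  have hyc : Continuous y := hPc.comp (by fun_prop)
  have hvar : ∀ u, ∀ z ∈ A, ∑ i, (1 + t * u i - y u i) * (z i - y u i) ≤ 0 := by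
    intro u z hz
    have := (hP (WithLp.toLp 2 fun i => 1 + t * u i)).2 z hz
    simp only [PiLp.inner_apply] at this
    convert this using 2 with i
    simp [y, mul_comm]
  -- The point 1 + tu lies above the whole cube, so if k ∈ K dominates y u, the variational
  -- inequality bounds |k - y u|² by 0, and y u = k.
  have hyK : ∀ u ∈ stdSimplex ℝ I, y u ∈ K := by
    intro u hu
    obtain ⟨k, hk, hle⟩ := hdom _ (hyA u)
    have h0 : ∑ i, (k i - y u i) * (k i - y u i) ≤ 0 := by
      refine le_trans (sum_le_sum fun i _ => ?_) (hvar u k (hKA hk))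
      refine mul_le_mul_of_nonneg_right ?_ (sub_nonneg.2 (hle i))
      have := (hcube k (hKA hk) i).2
      have := mul_nonneg ht.le (hu.1 i)
      linarith
    have h1 := (sum_eq_zero_iff_of_nonneg fun i _ => mul_self_nonneg (k i - y u i)).1
      (le_antisymm h0 (sum_nonneg fun i _ => mul_self_nonneg _))
    have : y u = k := by
      ext i
      have := mul_self_eq_zero.1 (h1 i (mem_univ i))
      linarith
    rwa [this]
  have hvc : ContinuousOn (fun u i => f (y u) i - y u i) (stdSimplex ℝ I) := by
    have h1 : ContinuousOn (fun u => f (y u)) (stdSimplex ℝ I) :=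
      hf.comp hyc.continuousOn hyK
    refine continuousOn_pi.2 fun i => ?_
    exact ((EuclideanSpace.proj (𝕜 := ℝ) i).continuous.comp_continuousOn h1).sub
      ((EuclideanSpace.proj (𝕜 := ℝ) i).continuous.comp hyc).continuousOn
  obtain ⟨u, hu, hle⟩ := exists_forall_le_of_sum_mul_le hvc (ε := Fintype.card I / t)
    (by positivity) (by
      intro u hu
      have h1 := hvar u _ (hmaps (hyK u hu))
      -- In the unit cube (1 - y_i)(f_i - y_i) ≥ -1, which bounds the part of the product without t.
      have h2 : ∑ i, (t * (u i * (f (y u) i - y u i)) - 1) ≤ 0 := by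
        refine le_trans (sum_le_sum fun i _ => ?_) h1
        have h3 := hcube _ (hyA u) i
        have h4 := hcube _ (hmaps (hyK u hu)) i
        nlinarith
      rw [sum_sub_distrib, ← mul_sum, sum_const, card_univ, nsmul_eq_mul, mul_one] at h2
      rw [le_div_iff₀ ht]
      linarith)
  refine ⟨y u, hyK u hu, fun i => (hle i).trans_eq ?_⟩
  simp only [t]
  field_simp

end Variational

/-! ### Arithmetic of exp(-ηx) on [0, ∞]. -/

open scoped ENNReal
noncomputable section

namespace PredictionGame

open Finset

theorem expNeg_eq_rpow (η : ℝ) (x : ℝ≥0∞) : expNeg η x = EReal.exp (-(x : EReal)) ^ η := by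
  rw [expNeg, ← EReal.exp_mul, EReal.neg_mul, mul_comm]

theorem continuous_expNeg (η : ℝ) : Continuous (expNeg η) := by
  simp only [funext (expNeg_eq_rpow η)]
  exact ENNReal.continuous_rpow_const.comp
    (ENNReal.continuous_exp.comp (continuous_neg.comp continuous_coe_ennreal_ereal))

theorem expNeg_le_expNeg_iff {η : ℝ} (hη : 0 < η) {x y : ℝ≥0∞} :
    expNeg η x ≤ expNeg η y ↔ y ≤ x := by
  rw [expNeg_eq_rpow, expNeg_eq_rpow, ENNReal.rpow_le_rpow_iff hη, EReal.exp_le_exp_iff,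
    EReal.neg_le_neg_iff, EReal.coe_ennreal_le_coe_ennreal_iff]

theorem expNeg_injective {η : ℝ} (hη : 0 < η) : Function.Injective (expNeg η) := fun _ _ h =>
  le_antisymm ((expNeg_le_expNeg_iff hη).1 h.ge) ((expNeg_le_expNeg_iff hη).1 h.le)

theorem expNeg_zero (η : ℝ) : expNeg η 0 = 1 := by simp [expNeg]

theorem expNeg_top {η : ℝ} (hη : 0 < η) : expNeg η ∞ = 0 := by
  simp [expNeg_eq_rpow, hη]

theorem expNeg_coe (η : ℝ) (x : NNReal) :
    expNeg η x = ENNReal.ofReal (Real.exp (-(η * x))) := by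
  rw [← EReal.exp_coe]
  rfl

theorem expNeg_le_one {η : ℝ} (hη : 0 < η) (x : ℝ≥0∞) : expNeg η x ≤ 1 := by
  rw [← expNeg_zero η, expNeg_le_expNeg_iff hη]
  exact zero_le

theorem expNeg_ne_top {η : ℝ} (hη : 0 < η) (x : ℝ≥0∞) : expNeg η x ≠ ∞ :=
  ((expNeg_le_one hη x).trans_lt ENNReal.one_lt_top).ne

theorem expNeg_add {η : ℝ} (hη : 0 < η) (x y : ℝ≥0∞) :
    expNeg η (x + y) = expNeg η x * expNeg η y := by
  rw [expNeg_eq_rpow, expNeg_eq_rpow, expNeg_eq_rpow, ← ENNReal.mul_rpow_of_nonneg _ _ hη.le,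
    ← EReal.exp_add, EReal.coe_ennreal_add, EReal.neg_add (Or.inl (EReal.coe_ennreal_ne_bot x))
      (Or.inr (EReal.coe_ennreal_ne_bot y)), sub_eq_add_neg]

theorem expNeg_sum {ι : Type*} {η : ℝ} (hη : 0 < η) (s : Finset ι) (x : ι → ℝ≥0∞) :
    expNeg η (∑ i ∈ s, x i) = ∏ i ∈ s, expNeg η (x i) := by
  classical
  induction s using Finset.induction_on with
  | empty => simp [expNeg_zero]
  | insert i s hi ih => rw [sum_insert hi, prod_insert hi, expNeg_add hη, ih]

theorem expNeg_negLog {η : ℝ} (hη : 0 < η) {s : ℝ≥0∞} (hs : s ≤ 1) :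
    expNeg η (negLog η s) = s := by
  have h0 : (0 : EReal) ≤ ((1 / η : ℝ) : EReal) * (-ENNReal.log s) := by
    refine mul_nonneg (by exact_mod_cast (one_div_pos.2 hη).le) ?_
    rw [EReal.neg_nonneg, ENNReal.log_le_zero_iff]
    exact hs
  rw [expNeg, negLog, EReal.coe_toENNReal h0, ← mul_assoc, ← EReal.coe_mul,
    mul_one_div_cancel hη.ne', EReal.coe_one, one_mul, neg_neg, ENNReal.exp_log]

theorem le_negLog_of_le_expNeg {η : ℝ} (hη : 0 < η) {s x : ℝ≥0∞} (h : s ≤ expNeg η x) :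
    x ≤ negLog η s := by
  rw [← expNeg_le_expNeg_iff hη, expNeg_negLog hη (h.trans (expNeg_le_one hη x))]
  exact h

theorem le_add_log_of_mul_expNeg_le {η : ℝ} (hη : 0 < η) {p x y : ℝ≥0∞} (hp : p ≤ 1)
    (h : p * expNeg η y ≤ expNeg η x) :
    (x : EReal) ≤ (y : EReal) + ((1 / η : ℝ) : EReal) * ENNReal.log (1 / p) := by
  have hη' : 0 < 1 / η := one_div_pos.2 hη
  rcases eq_or_ne p 0 with rfl | hp0
  · rw [ENNReal.div_zero one_ne_zero, ENNReal.log_top, EReal.coe_mul_top_of_pos hη',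
      EReal.add_top_of_ne_bot (EReal.coe_ennreal_ne_bot y)]
    exact le_top
  lift p to NNReal using (hp.trans_lt ENNReal.one_lt_top).ne
  have hpos : (0 : ℝ) < p := by
    have : p ≠ 0 := by exact_mod_cast hp0
    positivity
  have hlog : ENNReal.log (1 / (p : ℝ≥0∞)) = ((-Real.log p : ℝ) : EReal) := by
    rw [one_div, ENNReal.log_inv, ENNReal.log_of_nnreal (by exact_mod_cast hp0)]
    rfl
  rw [hlog, ← EReal.coe_mul]
  rcases eq_or_ne y ∞ with rfl | hy
  · rw [EReal.coe_ennreal_top, EReal.top_add_coe]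
    exact le_top
  lift y to NNReal using hy
  rw [expNeg_coe, ← ENNReal.ofReal_coe_nnreal (p := p), ← ENNReal.ofReal_mul hpos.le] at h
  rcases eq_or_ne x ∞ with rfl | hx
  · rw [expNeg_top hη, nonpos_iff_eq_zero, ENNReal.ofReal_eq_zero] at h
    exact absurd h (not_le.2 (by positivity))
  lift x to NNReal using hx
  rw [expNeg_coe, ENNReal.ofReal_le_ofReal_iff (Real.exp_pos _).le] at h
  have h1 := Real.log_le_log (by positivity) h
  rw [Real.log_mul hpos.ne' (Real.exp_pos _).ne', Real.log_exp, Real.log_exp] at h1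
  have h2 : (x : ℝ) ≤ y + 1 / η * -Real.log p := by
    rw [← mul_le_mul_iff_right₀ hη]
    field_simp
    linarith
  change ((x : ℝ) : EReal) ≤ ((y : ℝ) : EReal) + _
  exact_mod_cast h2

/-! ### Superpredictions as a compact convex set. -/

section Embedding

variable {Ω : Type*} {η : ℝ} {Λ : Set (Ω → ℝ≥0∞)}

/-- The point `exp (-η g)` of the unit cube. -/
def expPoint (η : ℝ) (g : Ω → ℝ≥0∞) : EuclideanSpace ℝ Ω :=
  WithLp.toLp 2 fun ω => (expNeg η (g ω)).toReal

theorem continuous_expPoint (hη : 0 < η) : Continuous (expPoint (Ω := Ω) η) := by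
  refine (PiLp.continuous_toLp 2 _).comp (continuous_pi fun ω => ?_)
  refine continuous_iff_continuousAt.2 fun g => ?_
  exact (ENNReal.tendsto_toReal (expNeg_ne_top hη _)).comp
    ((continuous_expNeg η).comp (continuous_apply ω)).continuousAt

theorem expPoint_injective (hη : 0 < η) : Function.Injective (expPoint (Ω := Ω) η) := by
  intro g h hgh
  funext ω
  have := congrArg (fun x : EuclideanSpace ℝ Ω => x ω) hgh
  exact expNeg_injective hη
    ((ENNReal.toReal_eq_toReal_iff' (expNeg_ne_top hη _) (expNeg_ne_top hη _)).1 this)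

/-- The set is the projection of a closed subset of the compact space Λ × [0, ∞]^Ω. -/
theorem isClosed_superpredictions (hΛ : IsCompact Λ) : IsClosed (superpredictions Λ) := by
  have h : superpredictions Λ = Prod.snd '' ((Λ ×ˢ Set.univ) ∩ {p | p.1 ≤ p.2}) := by
    ext g
    constructor
    · rintro ⟨γ, hγ, hle⟩
      exact ⟨(γ, g), ⟨⟨hγ, trivial⟩, hle⟩, rfl⟩
    · rintro ⟨⟨γ, _⟩, ⟨⟨hγ, -⟩, hle⟩, rfl⟩
      exact ⟨γ, hγ, hle⟩
  rw [h]
  exact (((hΛ.prod isCompact_univ).inter_right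
    (isClosed_le continuous_fst continuous_snd)).image continuous_snd).isClosed

theorem convex_expPoint_image [Fintype Ω] (hη : 0 < η) (hmix : IsMixable η Λ) :
    Convex ℝ (expPoint η '' superpredictions Λ) := by
  classical
  rintro _ ⟨g, hg, rfl⟩ _ ⟨h, hh, rfl⟩ a b ha hb hab
  -- If g = h the set {g, h} collapses and its weights would not sum to 1.
  rcases eq_or_ne g h with rfl | hne
  · exact ⟨g, hg, by rw [← add_smul, hab, one_smul]⟩
  have hab' : ENNReal.ofReal a + ENNReal.ofReal b = 1 := by
    rw [← ENNReal.ofReal_add ha hb, hab, ENNReal.ofReal_one]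
  let k : Ω → ℝ≥0∞ := fun ω =>
    negLog η (ENNReal.ofReal a * expNeg η (g ω) + ENNReal.ofReal b * expNeg η (h ω))
  have hk : k ∈ superpredictions Λ := by
    rw [hmix]
    refine ⟨{g, h}, fun x => if x = g then ENNReal.ofReal a else ENNReal.ofReal b, ?_, ?_, ?_⟩
    · intro x hx
      rcases mem_insert.1 (mem_coe.1 hx) with rfl | hx
      · exact hg
      · rw [mem_singleton.1 hx]; exact hh
    · rw [sum_pair hne, if_pos rfl, if_neg hne.symm, hab']
    · funext ω
      simp only [k, sum_pair hne, if_true, if_neg hne.symm]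
  refine ⟨k, hk, ?_⟩
  ext ω
  have hle : ENNReal.ofReal a * expNeg η (g ω) + ENNReal.ofReal b * expNeg η (h ω) ≤ 1 := by
    rw [← hab']
    exact add_le_add (mul_le_of_le_one_right' (expNeg_le_one hη _))
      (mul_le_of_le_one_right' (expNeg_le_one hη _))
  simp only [expPoint, k, expNeg_negLog hη hle, PiLp.add_apply, PiLp.smul_apply, smul_eq_mul]
  rw [ENNReal.toReal_add (ENNReal.mul_ne_top ENNReal.ofReal_ne_top (expNeg_ne_top hη _))
    (ENNReal.mul_ne_top ENNReal.ofReal_ne_top (expNeg_ne_top hη _)), ENNReal.toReal_mul,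
    ENNReal.toReal_mul, ENNReal.toReal_ofReal ha, ENNReal.toReal_ofReal hb]

end Embedding

end PredictionGame

/-- The missing mass is placed at 0. This covers partial sums of a countable mixture and the case of
vanishing weights. -/
theorem Convex.sum_smul_mem_of_zero_mem {E ι : Type*} [AddCommGroup E] [Module ℝ E] {A : Set E}
    (hA : Convex ℝ A) (h0 : (0 : E) ∈ A) {s : Finset ι} {w : ι → ℝ} {z : ι → E}
    (hw : ∀ i ∈ s, 0 ≤ w i) (hw1 : ∑ i ∈ s, w i ≤ 1) (hz : ∀ i ∈ s, z i ∈ A) :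
    ∑ i ∈ s, w i • z i ∈ A := by
  rcases (Finset.sum_nonneg hw).eq_or_lt with h | h
  · rw [Finset.sum_congr rfl fun i hi => by
      rw [(Finset.sum_eq_zero_iff_of_nonneg hw).1 h.symm i hi, zero_smul]]
    simpa using h0
  · have := hA.smul_mem_of_zero_mem h0 (hA.centerMass_mem hw h hz) ⟨h.le, hw1⟩
    rwa [Finset.centerMass, smul_inv_smul₀ h.ne'] at this

theorem exists_map_le_of_convex_of_injective {X I : Type*} [TopologicalSpace X] [CompactSpace X]
    [Fintype I] [Nonempty I] {k : X → EuclideanSpace ℝ I} (hk : Continuous k)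
    (hinj : Function.Injective k) {A : Set (EuclideanSpace ℝ I)} (hA : IsCompact A)
    (hconv : Convex ℝ A) (hne : A.Nonempty) (hcube : ∀ a ∈ A, ∀ i, 0 ≤ a i ∧ a i ≤ 1)
    (hkA : ∀ x, k x ∈ A) (hdom : ∀ a ∈ A, ∃ x, ∀ i, a i ≤ k x i)
    {f : X → EuclideanSpace ℝ I} (hf : Continuous f) (hfA : ∀ x, f x ∈ A) :
    ∃ x, ∀ i, f x i ≤ k x i := by
  have : Nonempty X := by
    obtain ⟨a, ha⟩ := hne
    exact ⟨(hdom a ha).choose⟩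
  have hinv : ∀ x, Function.invFun k (k x) = x := Function.leftInverse_invFun hinj
  obtain ⟨_, ⟨x, rfl⟩, hx⟩ := exists_map_le_self_of_convex (K := Set.range k) (A := A)
    (f := f ∘ Function.invFun k) (isCompact_range hk) hA hconv hne hcube
    (by rintro _ ⟨x, rfl⟩; exact hkA x)
    (fun a ha => by
      obtain ⟨x, hx⟩ := hdom a ha
      exact ⟨k x, ⟨x, rfl⟩, hx⟩)
    (by
      let e := (hk.isClosedEmbedding hinj).isEmbedding.toHomeomorph
      rw [continuousOn_iff_continuous_domRestrict]
      convert hf.comp e.symm.continuous using 1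
      funext ⟨y, x, hx⟩
      subst hx
      have : e.symm ⟨k x, x, rfl⟩ = x := e.symm_apply_apply x
      simp [hinv, this])
    (by rintro _ ⟨x, rfl⟩; exact hfA _)
  exact ⟨x, by simpa [hinv] using hx⟩

namespace PredictionGame

/-- In a mixable game Learner has a prediction that takes into account how the experts' forecasts
depend on it. -/
theorem exists_prediction_expNeg_ge {Ω Θ : Type*} [Finite Ω] [Nonempty Ω]
    {Λ : Set (Ω → ℝ≥0∞)} {η : ℝ} (hη : 0 < η) (hcompact : IsCompact Λ) (hne : Λ.Nonempty)
    (hmix : IsMixable η Λ) (p : Θ → ℝ≥0∞) (hp : ∑' θ, p θ ≤ 1) (Γ : Θ → C(Λ, Λ)) :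
    ∃ γ : Λ, ∀ o, ∑' θ, p θ * expNeg η ((Γ θ γ : Ω → ℝ≥0∞) o) ≤
      expNeg η ((γ : Ω → ℝ≥0∞) o) := by
  have := Fintype.ofFinite Ω
  have : CompactSpace Λ := isCompact_iff_compactSpace.1 hcompact
  have hptop : ∑' θ, p θ ≠ ∞ := (hp.trans_lt ENNReal.one_lt_top).ne
  have hpθ : ∀ θ, p θ ≠ ∞ := ENNReal.ne_top_of_tsum_ne_top hptop
  have hpsum : Summable fun θ => (p θ).toReal := ENNReal.summable_toReal hptop
  have hps : ∀ s : Finset Θ, ∑ θ ∈ s, (p θ).toReal ≤ 1 := by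
    intro s
    rw [← ENNReal.toReal_sum fun θ _ => hpθ θ]
    exact ENNReal.toReal_le_of_le_ofReal one_pos.le
      (by rw [ENNReal.ofReal_one]; exact (ENNReal.sum_le_tsum s).trans hp)
  have hsub : Λ ⊆ superpredictions Λ := fun γ hγ => ⟨γ, hγ, le_rfl⟩
  set A := expPoint η '' superpredictions Λ with hAdef
  have hA : IsCompact A := (isClosed_superpredictions hcompact).isCompact.image
    (continuous_expPoint hη)
  have hconv : Convex ℝ A := convex_expPoint_image hη hmix
  obtain ⟨γ₀, hγ₀⟩ := hne
  -- The origin is the image of the loss that is ∞ everywhere, a superprediction.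
  have h0 : (0 : EuclideanSpace ℝ Ω) ∈ A := by
    refine ⟨fun _ => ∞, ⟨γ₀, hγ₀, fun _ => le_top⟩, ?_⟩
    ext ω
    simp [expPoint, expNeg_top hη]
  have hkA : ∀ γ : Λ, expPoint η (γ : Ω → ℝ≥0∞) ∈ A := fun γ => ⟨γ, hsub γ.2, rfl⟩
  have hkc : Continuous fun γ : Λ => expPoint η (γ : Ω → ℝ≥0∞) :=
    (continuous_expPoint hη).comp continuous_subtype_val
  obtain ⟨B, hB⟩ := hA.isBounded.exists_norm_le
  have hnorm : ∀ θ (γ : Λ), ‖(p θ).toReal • expPoint η (Γ θ γ : Ω → ℝ≥0∞)‖ ≤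
      (p θ).toReal * B := by
    intro θ γ
    rw [norm_smul, Real.norm_of_nonneg ENNReal.toReal_nonneg]
    exact mul_le_mul_of_nonneg_left (hB _ (hkA _)) ENNReal.toReal_nonneg
  have hsummable : ∀ γ : Λ, Summable fun θ => (p θ).toReal • expPoint η (Γ θ γ : Ω → ℝ≥0∞) :=
    fun γ => Summable.of_norm_bounded (hpsum.mul_right B) fun θ => hnorm θ γ
  have hterm : ∀ θ, Continuous fun γ : Λ => (p θ).toReal • expPoint η (Γ θ γ : Ω → ℝ≥0∞) :=
    fun θ => Continuous.const_smul (hkc.comp (Γ θ).continuous) (p θ).toReal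
  obtain ⟨γ, hγ⟩ := exists_map_le_of_convex_of_injective
    (k := fun γ : Λ => expPoint η (γ : Ω → ℝ≥0∞))
    (f := fun γ : Λ => ∑' θ, (p θ).toReal • expPoint η (Γ θ γ : Ω → ℝ≥0∞)) hkc
    ((expPoint_injective hη).comp Subtype.val_injective) hA hconv ⟨0, h0⟩
    (by
      rintro _ ⟨g, -, rfl⟩ ω
      exact ⟨ENNReal.toReal_nonneg,
        ENNReal.toReal_le_of_le_ofReal one_pos.le (by simpa using expNeg_le_one hη (g ω))⟩)
    hkA
    (by
      rintro _ ⟨g, ⟨γ, hγ, hle⟩, rfl⟩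
      refine ⟨⟨γ, hγ⟩, fun ω => ?_⟩
      exact ENNReal.toReal_mono (expNeg_ne_top hη _) ((expNeg_le_expNeg_iff hη).2 (hle ω)))
    (continuous_tsum hterm (hpsum.mul_right B) hnorm)
    -- The countable mixture is a limit of finite sub-mixtures, which stay in the closed set A.
    (fun γ => hA.isClosed.mem_of_tendsto (hsummable γ).hasSum (Filter.Eventually.of_forall fun s =>
      hconv.sum_smul_mem_of_zero_mem h0 (fun _ _ => ENNReal.toReal_nonneg) (hps s)
        fun θ _ => hkA _))
  refine ⟨γ, fun o => ?_⟩
  have h1 := hγ o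
  have h2 : (∑' θ, (p θ).toReal • expPoint η (Γ θ γ : Ω → ℝ≥0∞)) o =
      (∑' θ, p θ * expNeg η ((Γ θ γ : Ω → ℝ≥0∞) o)).toReal := by
    rw [ENNReal.tsum_toReal_eq fun θ => ENNReal.mul_ne_top (hpθ θ) (expNeg_ne_top hη _)]
    refine ((EuclideanSpace.proj (𝕜 := ℝ) o).map_tsum (hsummable γ)).trans ?_
    simp [expPoint]
  have h3 : ∑' θ, p θ * expNeg η ((Γ θ γ : Ω → ℝ≥0∞) o) ≠ ∞ :=
    ne_top_of_le_ne_top hptop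
      (ENNReal.tsum_le_tsum fun θ => mul_le_of_le_one_right' (expNeg_le_one hη _))
  change (∑' θ, (p θ).toReal • expPoint η (Γ θ γ : Ω → ℝ≥0∞)) o ≤ _ at h1
  rw [h2] at h1
  exact (ENNReal.toReal_le_toReal h3 (expNeg_ne_top hη _)).1 h1

/-! ### The strategy and its loss bound. -/

section Strategy

variable {Ω Θ : Type*} {Λ : Set (Ω → ℝ≥0∞)}

/-- Weights divided by their sum (all zero if the weights are all zero). -/
def normalized (w : Θ → ℝ≥0∞) (θ : Θ) : ℝ≥0∞ := w θ / ∑' θ', w θ'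

theorem tsum_normalized_le_one (w : Θ → ℝ≥0∞) : ∑' θ, normalized w θ ≤ 1 := by
  simp only [normalized, div_eq_mul_inv]
  rw [ENNReal.tsum_mul_right]
  exact ENNReal.mul_inv_le_one _

/-- The weights of the Aggregating Algorithm when Learner chooses predictions by the rule `step`
from the weights and the functions announced by the experts. -/
def stepWeight (η : ℝ) (step : (Θ → ℝ≥0∞) → (Θ → C(Λ, Λ)) → Λ) (w₀ : Θ → ℝ≥0∞)
    (Γ : ℕ → Θ → C(Λ, Λ)) (ω : ℕ → Ω) : ℕ → Θ → ℝ≥0∞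
  | 0 => w₀
  | n + 1 => fun θ => stepWeight η step w₀ Γ ω n θ *
      expNeg η ((Γ n θ (step (stepWeight η step w₀ Γ ω n) (Γ n)) : Ω → ℝ≥0∞) (ω n))

theorem stepWeight_congr (η : ℝ) (step : (Θ → ℝ≥0∞) → (Θ → C(Λ, Λ)) → Λ) (w₀ : Θ → ℝ≥0∞)
    {Γ Γ' : ℕ → Θ → C(Λ, Λ)} {ω ω' : ℕ → Ω} (n : ℕ) (hΓ : ∀ k < n, Γ k = Γ' k)
    (hω : ∀ k < n, ω k = ω' k) :
    stepWeight η step w₀ Γ ω n = stepWeight η step w₀ Γ' ω' n := by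
  induction n with
  | zero => rfl
  | succ n ih =>
    simp only [stepWeight, ih (fun k hk => hΓ k (hk.trans n.lt_succ_self))
      (fun k hk => hω k (hk.trans n.lt_succ_self)), hΓ n n.lt_succ_self, hω n n.lt_succ_self]

/-- The strategy that predicts by the rule `step` from the weights. -/
def stepStrategy [Nonempty Ω] (η : ℝ) (step : (Θ → ℝ≥0∞) → (Θ → C(Λ, Λ)) → Λ)
    (w₀ : Θ → ℝ≥0∞) : Strategy Θ Λ := fun n Γ ω =>
  step (stepWeight η step w₀
    -- The padding is immaterial: the weights at step n depend only on indices below n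
    -- (`stepWeight_congr`).
    (fun k => if h : k < n + 1 then Γ ⟨k, h⟩ else fun _ => ContinuousMap.id _)
    (fun k => if h : k < n then ω ⟨k, h⟩ else Classical.arbitrary Ω) n) (Γ (Fin.last n))

variable [Nonempty Ω] (η : ℝ) (step : (Θ → ℝ≥0∞) → (Θ → C(Λ, Λ)) → Λ)

theorem prediction_stepStrategy (w₀ : Θ → ℝ≥0∞) (Γ : ℕ → Θ → C(Λ, Λ)) (ω : ℕ → Ω) (n : ℕ) :
    prediction (stepStrategy η step w₀) Γ ω n =
      step (stepWeight η step w₀ Γ ω n) (Γ n) := by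
  have : stepWeight η step w₀
      (fun k => if h : k < n + 1 then Γ (⟨k, h⟩ : Fin (n + 1)) else fun _ => ContinuousMap.id _)
      (fun k => if h : k < n then ω (⟨k, h⟩ : Fin n) else Classical.arbitrary Ω) n =
        stepWeight η step w₀ Γ ω n :=
    stepWeight_congr η step w₀ n (fun k hk => by simp [hk.trans n.lt_succ_self])
      (fun k hk => by simp [hk])
  simp only [prediction, stepStrategy, this, Fin.val_last]

theorem weight_stepStrategy (P₀ : PMF Θ) (Γ : ℕ → Θ → C(Λ, Λ)) (ω : ℕ → Ω) (n : ℕ) :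
    weight η P₀ (stepStrategy η step P₀) Γ ω n = stepWeight η step P₀ Γ ω n := by
  induction n with
  | zero => funext θ; simp [weight, stepWeight]
  | succ n ih =>
    funext θ
    have := congrFun ih θ
    rw [weight] at this
    rw [weight, Finset.prod_range_succ, ← mul_assoc, this, stepWeight, expertStepLoss,
      prediction_stepStrategy]

end Strategy

theorem tsum_weight_ne_top {Ω Θ : Type*} {Λ : Set (Ω → ℝ≥0∞)} {η : ℝ} (hη : 0 < η)
    (P₀ : PMF Θ) (S : Strategy Θ Λ) (Γ : ℕ → Θ → C(Λ, Λ)) (ω : ℕ → Ω) (N : ℕ) :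
    ∑' θ, weight η P₀ S Γ ω N θ ≠ ∞ := by
  refine ne_top_of_le_ne_top (b := 1) ENNReal.one_ne_top ?_
  rw [← P₀.tsum_coe]
  exact ENNReal.tsum_le_tsum fun θ =>
    mul_le_of_le_one_right' (Finset.prod_le_one' fun n _ => expNeg_le_one hη _)

theorem tsum_weight_le_expNeg_learnerLoss {Ω Θ : Type*} {Λ : Set (Ω → ℝ≥0∞)} {η : ℝ}
    (hη : 0 < η) (P₀ : PMF Θ) (S : Strategy Θ Λ) (Γ : ℕ → Θ → C(Λ, Λ)) (ω : ℕ → Ω)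
    (h : ∀ n, ∑' θ, normalized (weight η P₀ S Γ ω n) θ *
      expNeg η ((Γ n θ (prediction S Γ ω n) : Ω → ℝ≥0∞) (ω n)) ≤
        expNeg η ((prediction S Γ ω n : Ω → ℝ≥0∞) (ω n)))
    (N : ℕ) :
    ∑' θ, weight η P₀ S Γ ω N θ ≤ expNeg η (learnerLoss S Γ ω N) := by
  rw [learnerLoss, expNeg_sum hη]
  induction N with
  | zero => simp [weight]
  | succ n ih =>
    rw [Finset.prod_range_succ]
    refine le_trans (le_of_eq ?_) (mul_le_mul' ih (h n))
    rw [← ENNReal.tsum_mul_left]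
    refine tsum_congr fun θ => ?_
    rw [normalized, ← mul_assoc, weight, Finset.prod_range_succ, ← mul_assoc, ← weight, expertStepLoss]
    congr 1
    -- Normalization cancels against the total weight, also when the total is 0, because every
    -- weight is then 0.
    rcases eq_or_ne (∑' θ, weight η P₀ S Γ ω n θ) 0 with h0 | h0
    · rw [h0, zero_mul]
      exact ENNReal.tsum_eq_zero.1 h0 θ
    · rw [ENNReal.mul_div_cancel h0 (tsum_weight_ne_top hη P₀ S Γ ω n)]

end PredictionGame

end

theorem mainTheorem7 {Ω Θ : Type*} [Finite Ω] [Nonempty Ω] [Countable Θ]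
    (Λ : Set (Ω → ℝ≥0∞)) (η : ℝ) (hη : 0 < η)
    (hcompact : IsCompact Λ)
    (hfin : ∃ g ∈ Λ, ∀ ω, g ω < ∞)
    (hmix : PredictionGame.IsMixable η Λ)
    (P₀ : PMF Θ) :
    ∃ S : PredictionGame.Strategy Θ Λ,
      PredictionGame.IsModifiedAA η P₀ S ∧
      ∀ (Γ : ℕ → Θ → C(Λ, Λ)) (ω : ℕ → Ω) (N : ℕ) (θ : Θ),
        (PredictionGame.learnerLoss S Γ ω N : EReal) ≤
          (PredictionGame.expertLoss S Γ ω θ N : EReal) +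
            ((1 / η : ℝ) : EReal) * ENNReal.log (1 / P₀ θ) := by
  obtain ⟨g, hg, -⟩ := hfin
  choose step hstep using fun (w : Θ → ℝ≥0∞) =>
    PredictionGame.exists_prediction_expNeg_ge hη hcompact ⟨g, hg⟩ hmix _
      (PredictionGame.tsum_normalized_le_one w)
  let S := PredictionGame.stepStrategy η step P₀
  have key : ∀ Γ ω N o, ∑' θ, PredictionGame.normalized (PredictionGame.weight η P₀ S Γ ω N) θ *
      PredictionGame.expNeg η ((Γ N θ (PredictionGame.prediction S Γ ω N) : Ω → ℝ≥0∞) o) ≤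
        PredictionGame.expNeg η ((PredictionGame.prediction S Γ ω N : Ω → ℝ≥0∞) o) := by
    intro Γ ω N o
    rw [PredictionGame.weight_stepStrategy, PredictionGame.prediction_stepStrategy]
    exact hstep _ (Γ N) o
  refine ⟨S, fun Γ ω N o => PredictionGame.le_negLog_of_le_expNeg hη (key Γ ω N o),
    fun Γ ω N θ => PredictionGame.le_add_log_of_mul_expNeg_le hη (P₀.coe_le_one θ) ?_⟩
  have hweight := PredictionGame.tsum_weight_le_expNeg_learnerLoss hη P₀ S Γ ω
    (fun n => key Γ ω n (ω n)) N
  -- One expert's weight is at most the total weight.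
  refine le_trans ?_ ((ENNReal.le_tsum θ).trans hweight)
  rw [PredictionGame.expertLoss, PredictionGame.expNeg_sum hη, PredictionGame.weight]
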